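/- A SAS$^+$ instance $\mathbb P=\langle V,D,A,I,G\rangle$ consists of finite sets $V$ of variables, $D$ of values and $A$ of actions, an initial state $I\colon V\to D$, a goal $G\colon V\to D\cup\{\mathbf u\}$ (where $\mathbf u\notin D$ means "undefined"), and for each $a\in A$ a precondition $\mathrm{pre}(a)$ and an effect $\mathrm{eff}(a)$, both maps $V\to D\cup\{\mathbf u\}$. An action $a$ is valid in a state $s\colon V\to D$ if $\mathrm{pre}(a)[v]\in\{s[v],\mathbf u\}$ for all $v\in V$; its result in $s$ is the state that takes the value $\mathrm{eff}(a)[v]$ at $v$ where this is not $\mathbf u$, and $s[v]$ otherwise. A plan for $\mathbb P$ is a finite (possibly empty) sequence of actions that, applied one after the other starting from $I$, are each valid in the state in which they are applied and that lead to a state $s$ with $G[v]\in\{s[v],\mathbf u\}$ for all $v\in V$. Bounded SAS$^+$ Planning is the following parameterized problem: given a SAS$^+$ instance $\mathbb P$ and a positive integer $k$, the parameter, does $\mathbb P$ have a plan of length at most $k$? Restriction B says that $|D|=2$. Restriction S says that for all $a,b\in A$ and $v\in V$, if $\mathrm{pre}(a)[v]\ne\mathbf u$, $\mathrm{pre}(b)[v]\ne\mathbf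 u$ and $\mathrm{eff}(a)[v]=\mathrm{eff}(b)[v]=\mathbf u$, then $\mathrm{pre}(a)[v]=\mathrm{pre}(b)[v]$. A parameterized reduction from a parameterized problem $L$ to a parameterized problem $L'$ is a map $R$ from the instances $\langle x,k\rangle$ of $L$ to the instances $\langle x',k'\rangle$ of $L'$ that preserves the answer (yes or no), such that $k'\le g(k)$ for a computable function $g$, and such that $R$ can be computed in time $O(f(k)\cdot n^{c})$ for a computable function $f$ and a constant $c$, where $n$ is the size of $\langle x,k\rangle$. The class W[2] consists of all parameterized problems that have a parameterized reduction to Weighted 2-Normalized Satisfiability (given a Boolean formula in conjunctive normal form and a number $k$, the parameter, is there a satisfying assignment that makes exactly $k$ variables true?). A problem is W[2]-hard if every problem in W[2] has a parameterized reduction to it. **Theorem.** Bounded SAS$^+$ Planning restricted to the instances that satisfy B and S is W[2]-hard. It remains W[2]-hard when restricted further to the instances in which no action has a precondition (that is, $\mathrm{pre}(a)[v]=\mathbf u$ for all $a\in A$ and $v\in V$). -/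

import Mathlib

namespace ParamPlanning

/-! ## Machine model

Data are binary trees, programs are built from the usual LISP-like primitives, sequencing,
branching and an unbounded loop.  Every primitive is charged with the full size of the tree it is
applied to, so that the running time of a program is never smaller than the size of its input, of
its output or of an intermediate result (see `Runs.size_le`).  Hence a run of `t` steps can be
simulated by a multi-tape Turing machine in time polynomial in `t`, and one step of a Turing machine
is a fixed composition of primitives applied to a tree holding the configuration: running times
agree with Turing machine time up to a polynomial. -/

/-- Binary trees. -/
inductive Data : Type
  | nil : Data
  | node : Data → Data → Data

/-- The number of nodes and leaves of a tree. -/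
def Data.size : Data → ℕ
  | .nil => 1
  | .node l r => l.size + r.size + 1

/-- Left subtree (`nil` on `nil`). -/
def Data.left : Data → Data
  | .nil => .nil
  | .node l _ => l

/-- Right subtree (`nil` on `nil`). -/
def Data.right : Data → Data
  | .nil => .nil
  | .node _ r => r

/-- Programs; each one maps trees to trees. -/
inductive Prog : Type
  | nil : Prog
  | id : Prog
  | left : Prog
  | right : Prog
  | node : Prog → Prog → Prog
  | seq : Prog → Prog → Prog
  | ite : Prog → Prog → Prog → Prog
  | loop : Prog → Prog → Prog

/-- `Runs p x y t`: the program `p`, started on the tree `x`, halts with output `y` after exactly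
`t` time units. -/
inductive Runs : Prog → Data → Data → ℕ → Prop
  /-- the constant `nil` -/
  | nil (x : Data) : Runs .nil x .nil (x.size + 1)
  /-- the identity -/
  | id (x : Data) : Runs .id x x (x.size + 1)
  /-- left subtree -/
  | left (x : Data) : Runs .left x x.left (x.size + 1)
  /-- right subtree -/
  | right (x : Data) : Runs .right x x.right (x.size + 1)
  /-- run `p` and `q` on the same input and join the two results -/
  | node {p q : Prog} {x y z : Data} {s t : ℕ} (hp : Runs p x y s) (hq : Runs q x z t) :
      Runs (.node p q) x (.node y z) (s + t + 1)
  /-- first `p`, then `q` on the result -/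
  | seq {p q : Prog} {x y z : Data} {s t : ℕ} (hp : Runs p x y s) (hq : Runs q y z t) :
      Runs (.seq p q) x z (s + t + 1)
  /-- the test `b` succeeds (its value is not `nil`) -/
  | ite_true {b p q : Prog} {x l r y : Data} {s t : ℕ} (hb : Runs b x (.node l r) s)
      (hp : Runs p x y t) : Runs (.ite b p q) x y (s + t + 1)
  /-- the test `b` fails (its value is `nil`) -/
  | ite_false {b p q : Prog} {x y : Data} {s t : ℕ} (hb : Runs b x .nil s)
      (hq : Runs q x y t) : Runs (.ite b p q) x y (s + t + 1)
  /-- the test `b` fails: leave the loop -/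
  | loop_done {b p : Prog} {x : Data} {s : ℕ} (hb : Runs b x .nil s) :
      Runs (.loop b p) x x (s + 1)
  /-- the test `b` succeeds: execute the body `p` and repeat -/
  | loop_step {b p : Prog} {x l r y z : Data} {s t u : ℕ} (hb : Runs b x (.node l r) s)
      (hp : Runs p x y t) (hl : Runs (.loop b p) y z u) : Runs (.loop b p) x z (s + t + u + 1)

/-- Time bounds the size of the input and of the output of every (sub)computation. -/
theorem Runs.size_le {p : Prog} {x y : Data} {t : ℕ} (h : Runs p x y t) :
    x.size ≤ t ∧ y.size ≤ t := by
  induction h with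
  | nil x => cases x <;> simp [Data.size]
  | id x => simp
  | left x => cases x <;> simp [Data.size, Data.left]; omega
  | right x => cases x <;> simp [Data.size, Data.right]; omega
  | node _ _ h1 h2 => simp only [Data.size]; omega
  | seq _ _ h1 h2 => omega
  | ite_true _ _ h1 h2 => omega
  | ite_false _ _ h1 h2 => omega
  | loop_done _ h => omega
  | loop_step _ _ _ h1 h2 h3 => omega

/-! ## Encodings of finite objects as trees -/

/-- Natural numbers, in unary. -/
def encNat : ℕ → Data
  | 0 => .nil
  | n + 1 => .node .nil (encNat n)

/-- Truth values. -/
def encBool : Bool → Data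
  | false => .nil
  | true => .node .nil .nil

/-- Lists, given an encoding of the entries. -/
def encList {α : Type} (e : α → Data) : List α → Data
  | [] => .nil
  | a :: l => .node (e a) (encList e l)

/-- Optional values, given an encoding of the values. -/
def encOption {α : Type} (e : α → Data) : Option α → Data
  | none => .nil
  | some a => .node (e a) .nil

/-- Tuples, as the list of their entries. -/
def encTuple {α : Type} {n : ℕ} (e : α → Data) (f : Fin n → α) : Data :=
  encList e (List.ofFn f)

/-- Elements of `{0, …, n - 1}`. -/
def encFin {n : ℕ} (i : Fin n) : Data := encNat i

theorem encNat_injective : Function.Injective encNat := by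
  intro m
  induction m with
  | zero => intro n h; cases n <;> simp_all [encNat]
  | succ m ih =>
    intro n h
    cases n with
    | zero => simp [encNat] at h
    | succ n => simp only [encNat, Data.node.injEq, true_and] at h; rw [ih h]

theorem encBool_injective : Function.Injective encBool := by
  intro a b h
  cases a <;> cases b <;> simp_all [encBool]

theorem encList_injective {α : Type} {e : α → Data} (he : Function.Injective e) :
    Function.Injective (encList e) := by
  intro l
  induction l with
  | nil => intro l' h; cases l' <;> simp_all [encList]
  | cons a l ih =>
    intro l' h
    cases l' with
    | nil => simp [encList] at h
    | cons b l' =>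
      simp only [encList, Data.node.injEq] at h
      rw [he h.1, ih h.2]

theorem encOption_injective {α : Type} {e : α → Data} (he : Function.Injective e) :
    Function.Injective (encOption e) := by
  intro a b h
  cases a <;> cases b <;> simp_all [encOption]
  exact he h

theorem encTuple_injective {α : Type} {n : ℕ} {e : α → Data} (he : Function.Injective e) :
    Function.Injective (encTuple e : (Fin n → α) → Data) := fun _ _ h =>
  List.ofFn_injective (encList_injective he h)

theorem encFin_injective {n : ℕ} : Function.Injective (encFin : Fin n → Data) := fun _ _ h =>
  Fin.ext (encNat_injective h)

/-! ## Parameterized complexity -/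

/-- A parameterized (decision) problem: a set of instances, each of which is a pair of a main part
(written as a tree) and a parameter, with the set of yes-instances singled out. -/
structure ParamProblem where
  /-- the instances -/
  Inst : Type
  /-- the main part of an instance, as a tree -/
  main : Inst → Data
  /-- the parameter of an instance -/
  param : Inst → ℕ
  /-- an instance is determined by the pair of its main part and its parameter -/
  pair_injective : Function.Injective fun x => (main x, param x)
  /-- the yes-instances -/
  Yes : Inst → Prop

/-- The tree that represents the pair (main part, parameter). -/
def ParamProblem.code (L : ParamProblem) (x : L.Inst) : Data :=
  .node (L.main x) (encNat (L.param x))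

/-- The size of an instance. -/
def ParamProblem.size (L : ParamProblem) (x : L.Inst) : ℕ := (L.code x).size

/-- Parameterized reductions: a map `R` from the instances of `L` to those of `L'` that preserves
the answer, whose new parameter is bounded by a computable function `g` of the old one, and which a
program computes in time `f(k) * n ^ c` for a computable function `f` and a constant `c`, where `k`
is the parameter and `n` the size of the given instance. -/
def FPTReduces (L L' : ParamProblem) : Prop :=
  ∃ R : L.Inst → L'.Inst,
    (∀ x, L.Yes x ↔ L'.Yes (R x)) ∧
    (∃ g : ℕ → ℕ, Computable g ∧ ∀ x, L'.param (R x) ≤ g (L.param x)) ∧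
    ∃ (p : Prog) (f : ℕ → ℕ) (c : ℕ), Computable f ∧
      ∀ x, ∃ t, t ≤ f (L.param x) * L.size x ^ c ∧ Runs p (L.code x) (L'.code (R x)) t

/-- An instance of Weighted 2-Normalized Satisfiability: a product of sums of literals (that is, a
formula in conjunctive normal form) in the variables `0, …, numVars - 1`, and a weight. The literal
`(i, true)` is the variable `i`, and `(i, false)` is its negation. -/
structure WSatInst where
  /-- number of variables -/
  numVars : ℕ
  /-- the clauses -/
  clauses : List (List (Fin numVars × Bool))
  /-- the required weight -/
  k : ℕ

/-- Encoding of a literal. -/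
def encLit {n : ℕ} (l : Fin n × Bool) : Data := .node (encFin l.1) (encBool l.2)

theorem encLit_injective {n : ℕ} : Function.Injective (encLit : Fin n × Bool → Data) := by
  rintro ⟨i, a⟩ ⟨j, b⟩ h
  simp only [encLit, Data.node.injEq] at h
  rw [encFin_injective h.1, encBool_injective h.2]

/-- The formula of an instance, as a tree. -/
def WSatInst.enc (x : WSatInst) : Data :=
  .node (encNat x.numVars) (encList (encList encLit) x.clauses)

/-- There is a satisfying assignment of weight exactly `k`; an assignment is given by the set `T` of
the variables that it makes true. -/
def WSatInst.Yes (x : WSatInst) : Prop :=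
  ∃ T : Finset (Fin x.numVars), T.card = x.k ∧
    ∀ c ∈ x.clauses, ∃ l ∈ c, (l.1 ∈ T ↔ l.2 = true)

theorem WSatInst.enc_injective : Function.Injective fun x : WSatInst => (x.enc, x.k) := by
  rintro ⟨n, c, k⟩ ⟨n', c', k'⟩ h
  simp only [WSatInst.enc, Prod.mk.injEq, Data.node.injEq] at h
  obtain ⟨⟨h1, h2⟩, rfl⟩ := h
  obtain rfl := encNat_injective h1
  obtain rfl := encList_injective (encList_injective encLit_injective) h2
  rfl

/-- Weighted 2-Normalized Satisfiability, parameterized by the weight. -/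
def weightedTwoNormalizedSat : ParamProblem where
  Inst := WSatInst
  main := WSatInst.enc
  param := WSatInst.k
  pair_injective := WSatInst.enc_injective
  Yes := WSatInst.Yes

/-- The class W[2]: the problems with a parameterized reduction to Weighted 2-Normalized
Satisfiability. -/
def InW2 (L : ParamProblem) : Prop := FPTReduces L weightedTwoNormalizedSat

/-- W[2]-hardness under parameterized reductions. -/
def W2Hard (L : ParamProblem) : Prop := ∀ L' : ParamProblem, InW2 L' → FPTReduces L' L

/-! ## SAS⁺ planning -/

/-- A SAS⁺ instance with variables `V`, domain `D` and actions `A`.  Total states are maps `V → D`,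
partial states are maps `V → Option D`, where `none` is the undefined value. -/
structure SASPlus (V D A : Type) where
  /-- preconditions -/
  pre : A → V → Option D
  /-- effects -/
  eff : A → V → Option D
  /-- the initial state -/
  init : V → D
  /-- the goal -/
  goal : V → Option D

namespace SASPlus

variable {V D A : Type} (P : SASPlus V D A)

/-- The action `a` is valid in the state `s`. -/
def Valid (a : A) (s : V → D) : Prop := ∀ v, P.pre a v = some (s v) ∨ P.pre a v = none

/-- The result of the action `a` in the state `s`. -/
def result (a : A) (s : V → D) : V → D := fun v => (P.eff a v).getD (s v)

/-- The action sequence is a plan from the first state to the second one. -/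
def IsPlanFrom : List A → (V → D) → (V → D) → Prop
  | [], s, s' => s = s'
  | a :: w, s, s' => P.Valid a s ∧ IsPlanFrom w (P.result a s) s'

/-- Goal states. -/
def IsGoalState (s : V → D) : Prop := ∀ v, P.goal v = some (s v) ∨ P.goal v = none

/-- The action sequence is a plan for the instance. -/
def IsPlan (w : List A) : Prop := ∃ s, P.IsGoalState s ∧ P.IsPlanFrom w P.init s

/-- Restriction B: the domain has exactly two elements. -/
def RestrictionB (_ : SASPlus V D A) : Prop := Nat.card D = 2

/-- Restriction S (single-valuedness): any two actions that have a precondition, but no effect, on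
the same variable require the same value of it. -/
def RestrictionS : Prop :=
  ∀ (a b : A) (v : V), P.pre a v ≠ none → P.pre b v ≠ none →
    P.eff a v = none → P.eff b v = none → P.pre a v = P.pre b v

/-- No action has a precondition. -/
def NoPreconditions : Prop := ∀ (a : A) (v : V), P.pre a v = none

end SASPlus

/-- An instance of Bounded SAS⁺ Planning: a SAS⁺ instance with finitely many variables, values and
actions (each set numbered from `0`), and a positive integer. -/
structure PlanInst where
  /-- number of variables -/
  numVars : ℕ
  /-- size of the domain -/
  numVals : ℕ
  /-- number of actions -/
  numActs : ℕ
  /-- the SAS⁺ instance -/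
  sas : SASPlus (Fin numVars) (Fin numVals) (Fin numActs)
  /-- the bound on the plan length -/
  k : ℕ
  k_pos : 0 < k

/-- Encoding of partial states: the tuple of the (possibly undefined) values of the variables. -/
def encPartial {n d : ℕ} (s : Fin n → Option (Fin d)) : Data := encTuple (encOption encFin) s

theorem encPartial_injective {n d : ℕ} :
    Function.Injective (encPartial : (Fin n → Option (Fin d)) → Data) :=
  encTuple_injective (encOption_injective encFin_injective)

/-- The SAS⁺ instance, as a tree: number of variables, size of the domain, list of the preconditions
of the actions, list of their effects, initial state and goal. -/
def PlanInst.enc (x : PlanInst) : Data :=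
  .node (encNat x.numVars) <| .node (encNat x.numVals) <|
    .node (encList encPartial (List.ofFn x.sas.pre)) <|
      .node (encList encPartial (List.ofFn x.sas.eff)) <|
        .node (encTuple encFin x.sas.init) (encPartial x.sas.goal)

theorem PlanInst.enc_injective : Function.Injective fun x : PlanInst => (x.enc, x.k) := by
  rintro ⟨n, d, m, ⟨p, e, i, g⟩, k, hk⟩ ⟨n', d', m', ⟨p', e', i', g'⟩, k', hk'⟩ h
  simp only [PlanInst.enc, Prod.mk.injEq, Data.node.injEq] at h
  obtain ⟨⟨h1, h2, h3, h4, h5, h6⟩, rfl⟩ := h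
  obtain rfl := encNat_injective h1
  obtain rfl := encNat_injective h2
  have h3' := encList_injective encPartial_injective h3
  have h4' := encList_injective encPartial_injective h4
  have hm : m = m' := by simpa using congrArg List.length h3'
  obtain rfl := hm
  obtain rfl := List.ofFn_injective h3'
  obtain rfl := List.ofFn_injective h4'
  obtain rfl := encTuple_injective encFin_injective h5
  obtain rfl := encPartial_injective h6
  rfl

/-- Bounded SAS⁺ Planning, parameterized by the bound on the plan length, restricted to the
instances with the property `Q`: is there a plan of length at most `k`? -/
def boundedPlanning (Q : PlanInst → Prop) : ParamProblem where
  Inst := {x : PlanInst // Q x}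
  main x := x.1.enc
  param x := x.1.k
  pair_injective := fun _ _ h => Subtype.ext (PlanInst.enc_injective h)
  Yes x := ∃ w : List (Fin x.1.numActs), w.length ≤ x.1.k ∧ x.1.sas.IsPlan w

end ParamPlanning

/-! Parameterized reductions compose (`FPTReduces.trans`), so it suffices to reduce Weighted
2-Normalized Satisfiability itself. If no action has a precondition and every effect only writes 1,
the order of actions is irrelevant: a short plan is a choice of few actions that together cover all
variables (`coverSAS_exists_plan`).

The covering problem describes a set of `k` variables by the `k + 1` gaps around its members,
because the falsity of a variable can then be witnessed by a single chosen object. An action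
proposes one gap: its number and its two ends. Slot tests ask for a gap of every number, and the
budget `k + 1` leaves exactly one for each. Link tests make every gap begin just after the end of
the previous one. A positive literal holds if its variable ends a gap, a negative one if its
variable lies inside a gap, so a true clause is always covered by one action. The two directions are
`exists_cover` and `exists_of_cover`, joined in `WSatInst.yes_iff`.

There are polynomially many gaps and tests, and parameters are written in unary, so the map runs in
polynomial time. This is proved with combinators for `PolyTime`, whose core is a fold with
additively growing accumulator (`foldl_of_invariant`). The constructed instances have two values and
no preconditions, which makes S vacuous and settles both claims at once. -/

namespace ParamPlanning

/-! ## Polynomial-time functions between encoded types -/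

/-- Types whose elements are written as trees. -/
class TreeEnc (α : Type) where
  /-- the tree that represents an element -/
  enc : α → Data

open TreeEnc (enc)

instance : TreeEnc Unit := ⟨fun _ => .nil⟩
instance : TreeEnc ℕ := ⟨encNat⟩
instance : TreeEnc Bool := ⟨encBool⟩
instance {α : Type} [TreeEnc α] : TreeEnc (List α) := ⟨encList enc⟩
instance {α : Type} [TreeEnc α] : TreeEnc (Option α) := ⟨encOption enc⟩
instance {α β : Type} [TreeEnc α] [TreeEnc β] : TreeEnc (α × β) :=
  ⟨fun x => .node (enc x.1) (enc x.2)⟩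

/-- The size of the tree that represents an element. -/
def esize {α : Type} [TreeEnc α] (a : α) : ℕ := (enc a).size

theorem Data.size_pos (x : Data) : 0 < x.size := by cases x <;> simp [Data.size]

theorem enc_cons {α : Type} [TreeEnc α] (a : α) (l : List α) :
    enc (a :: l) = .node (enc a) (enc l) := rfl

theorem esize_pair {α β : Type} [TreeEnc α] [TreeEnc β] (a : α) (b : β) :
    esize (a, b) = esize a + esize b + 1 := rfl

theorem esize_nil {α : Type} [TreeEnc α] : esize ([] : List α) = 1 := rfl

theorem esize_cons {α : Type} [TreeEnc α] (a : α) (l : List α) :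
    esize (a :: l) = esize a + esize l + 1 := rfl

theorem esize_nat (n : ℕ) : esize n = 2 * n + 1 := by
  induction n with
  | zero => rfl
  | succ n ih =>
    have : esize (n + 1) = 1 + esize n + 1 := rfl
    omega

theorem esize_bool_le (b : Bool) : esize b ≤ 3 := by cases b <;> decide

theorem length_lt_esize {α : Type} [TreeEnc α] (l : List α) : l.length < esize l := by
  induction l with
  | nil => simp [esize_nil]
  | cons a l ih => simp only [esize_cons, List.length_cons]; omega

theorem esize_lt_of_mem {α : Type} [TreeEnc α] {a : α} {l : List α} (h : a ∈ l) :
    esize a < esize l := by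
  induction l with
  | nil => simp at h
  | cons b l ih =>
    rw [esize_cons]
    rcases List.mem_cons.1 h with rfl | h
    · omega
    · have := ih h; omega

theorem polynomial_eval_mono (q : Polynomial ℕ) {m n : ℕ} (h : m ≤ n) :
    q.eval m ≤ q.eval n := by
  rw [Polynomial.eval_eq_sum_range, Polynomial.eval_eq_sum_range]
  gcongr

/-- Bounds each monomial by the top power. This turns a polynomial time bound into the form `f k * n
^ c` that `FPTReduces` asks for, with constant `f`. -/
theorem polynomial_eval_le (q : Polynomial ℕ) {n : ℕ} (h : 0 < n) :
    q.eval n ≤ q.eval 1 * n ^ q.natDegree := by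
  rw [Polynomial.eval_eq_sum_range, Polynomial.eval_eq_sum_range, Finset.sum_mul]
  refine Finset.sum_le_sum fun i hi => ?_
  rw [one_pow, mul_one]
  exact Nat.mul_le_mul_left _ (Nat.pow_le_pow_right h (by simpa [Nat.lt_succ_iff] using hi))

/-- The function is computed by a program in polynomial time. -/
def PolyTime {α β : Type} [TreeEnc α] [TreeEnc β] (f : α → β) : Prop :=
  ∃ (p : Prog) (q : Polynomial ℕ), ∀ a, ∃ t, t ≤ q.eval (esize a) ∧ Runs p (enc a) (enc (f a)) t

namespace PolyTime

variable {α β γ σ : Type} [TreeEnc α] [TreeEnc β] [TreeEnc γ] [TreeEnc σ]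

/-- Writing the output is charged for, so running time bounds output size. Folds use this to control
their lists and accumulators. -/
theorem exists_esize_le {f : α → β} (hf : PolyTime f) :
    ∃ q : Polynomial ℕ, ∀ a, esize (f a) ≤ q.eval (esize a) := by
  obtain ⟨p, q, h⟩ := hf
  refine ⟨q, fun a => ?_⟩
  obtain ⟨t, ht, hr⟩ := h a
  exact hr.size_le.2.trans ht

/-- Functions that do not change the encoding. -/
theorem recode {f : α → β} (h : ∀ a, enc (f a) = enc a) : PolyTime f := by
  refine ⟨.id, Polynomial.X + 1, fun a => ⟨(enc a).size + 1, by simp [esize], ?_⟩⟩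
  rw [h]
  exact .id _

theorem fst : PolyTime (Prod.fst : α × β → α) :=
  ⟨.left, Polynomial.X + 1, fun a => ⟨(enc a).size + 1, by simp [esize], .left _⟩⟩

theorem snd : PolyTime (Prod.snd : α × β → β) :=
  ⟨.right, Polynomial.X + 1, fun a => ⟨(enc a).size + 1, by simp [esize], .right _⟩⟩

theorem comp {g : β → γ} {f : α → β} (hg : PolyTime g) (hf : PolyTime f) :
    PolyTime fun a => g (f a) := by
  obtain ⟨p, q, h⟩ := hf
  obtain ⟨p', q', h'⟩ := hg
  refine ⟨.seq p p', q + q'.comp q + 1, fun a => ?_⟩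
  obtain ⟨t, ht, hr⟩ := h a
  obtain ⟨t', ht', hr'⟩ := h' (f a)
  refine ⟨_, ?_, .seq hr hr'⟩
  have := polynomial_eval_mono q' (hr.size_le.2.trans ht)
  simp only [Polynomial.eval_add, Polynomial.eval_comp, Polynomial.eval_one]
  simp only [esize] at *
  omega

theorem node_prog {f : α → β} {g : α → γ} {h : α → σ} (hf : PolyTime f) (hg : PolyTime g)
    (e : ∀ a, enc (h a) = .node (enc (f a)) (enc (g a))) : PolyTime h := by
  obtain ⟨p, q, h⟩ := hf
  obtain ⟨p', q', h'⟩ := hg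
  refine ⟨.node p p', q + q' + 1, fun a => ?_⟩
  obtain ⟨t, ht, hr⟩ := h a
  obtain ⟨t', ht', hr'⟩ := h' a
  rw [e]
  refine ⟨_, ?_, .node hr hr'⟩
  simp only [Polynomial.eval_add, Polynomial.eval_one]
  omega

theorem pair {f : α → β} {g : α → γ} (hf : PolyTime f) (hg : PolyTime g) :
    PolyTime fun a => (f a, g a) := node_prog hf hg fun _ => rfl

theorem cons {f : α → β} {g : α → List β} (hf : PolyTime f) (hg : PolyTime g) :
    PolyTime fun a => f a :: g a := node_prog hf hg fun _ => rfl

theorem exists_const_prog (d : Data) : ∃ (p : Prog) (q : Polynomial ℕ), ∀ x : Data,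
    ∃ t, t ≤ q.eval x.size ∧ Runs p x d t := by
  induction d with
  | nil => exact ⟨.nil, Polynomial.X + 1, fun x => ⟨_, by simp, .nil x⟩⟩
  | node l r hl hr =>
    obtain ⟨p, q, h⟩ := hl
    obtain ⟨p', q', h'⟩ := hr
    refine ⟨.node p p', q + q' + 1, fun x => ?_⟩
    obtain ⟨t, ht, hr⟩ := h x
    obtain ⟨t', ht', hr'⟩ := h' x
    refine ⟨_, ?_, .node hr hr'⟩
    simp only [Polynomial.eval_add, Polynomial.eval_one]
    omega

theorem const (b : β) : PolyTime fun _ : α => b := by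
  obtain ⟨p, q, h⟩ := exists_const_prog (enc b)
  exact ⟨p, q, fun a => h (enc a)⟩

theorem succ {f : α → ℕ} (hf : PolyTime f) : PolyTime fun a => f a + 1 :=
  node_prog (const ()) hf fun _ => rfl

theorem pred {f : α → ℕ} (hf : PolyTime f) : PolyTime fun a => f a - 1 := by
  refine comp (g := fun n : ℕ => n - 1) ?_ hf
  refine ⟨.right, Polynomial.X + 1, fun a => ⟨(enc a).size + 1, by simp [esize], ?_⟩⟩
  have : enc (a - 1) = (enc a).right := by cases a <;> rfl
  exact this ▸ .right _

/-- Programs branch on whether a tree is `nil`, which encodes both `false` and `0`; Boolean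
connectives and the positivity test are all instances. -/
theorem ite_prog {c : α → β} {f g h : α → γ} (hc : PolyTime c) (hf : PolyTime f)
    (hg : PolyTime g)
    (e : ∀ a, enc (c a) ≠ .nil ∧ h a = f a ∨ enc (c a) = .nil ∧ h a = g a) : PolyTime h := by
  obtain ⟨p, q, h⟩ := hc
  obtain ⟨p', q', h'⟩ := hf
  obtain ⟨p'', q'', h''⟩ := hg
  refine ⟨.ite p p' p'', q + q' + q'' + 1, fun a => ?_⟩
  obtain ⟨t, ht, hr⟩ := h a
  obtain ⟨t', ht', hr'⟩ := h' a
  obtain ⟨t'', ht'', hr''⟩ := h'' a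
  simp only [Polynomial.eval_add, Polynomial.eval_one]
  rcases e a with ⟨h1, h2⟩ | ⟨h1, h2⟩
  · rw [h2]
    revert hr
    cases hd : enc (c a) with
    | nil => exact absurd hd h1
    | node l r => exact fun hr => ⟨_, by omega, .ite_true hr hr'⟩
  · rw [h1] at hr
    rw [h2]
    exact ⟨_, by omega, .ite_false hr hr''⟩

theorem cond {c : α → Bool} {f g : α → β} (hc : PolyTime c) (hf : PolyTime f)
    (hg : PolyTime g) : PolyTime fun a => bif c a then f a else g a :=
  ite_prog hc hf hg fun a => by
    cases h : c a <;> simp [enc, encBool]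

theorem not {c : α → Bool} (hc : PolyTime c) : PolyTime fun a => !c a :=
  ite_prog hc (const false) (const true) fun a => by cases h : c a <;> simp [enc, encBool]

theorem and {c d : α → Bool} (hc : PolyTime c) (hd : PolyTime d) :
    PolyTime fun a => c a && d a :=
  ite_prog hc hd (const false) fun a => by cases h : c a <;> simp [enc, encBool]

theorem or {c d : α → Bool} (hc : PolyTime c) (hd : PolyTime d) :
    PolyTime fun a => c a || d a :=
  ite_prog hc (const true) hd fun a => by cases h : c a <;> simp [enc, encBool]

theorem nat_pos {f : α → ℕ} (hf : PolyTime f) : PolyTime fun a => decide (0 < f a) :=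
  ite_prog hf (const true) (const false) fun a => by
    cases h : f a <;> simp [enc, encNat]

/-- The state of the loop that folds a list: the input, the rest of the list, the accumulator. -/
def foldBody (p : Prog) : Prog :=
  .node .left (.node (.seq .right (.seq .left .right))
    (.seq (.node .left (.node (.seq .right .right) (.seq .right (.seq .left .left)))) p))

/-- Apart from `p`, the body makes a fixed number of projections, each linear in the loop state; 30
is a generous allowance. -/
theorem foldBody_runs {p : Prog} {A H R S y : Data} {t : ℕ}
    (hp : Runs p (.node A (.node S H)) y t) :
    ∃ t', t' ≤ t + 30 * (Data.node A (.node (.node H R) S)).size + 30 ∧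
      Runs (foldBody p) (.node A (.node (.node H R) S)) (.node A (.node R y)) t' := by
  refine ⟨_, ?_, .node (.left _) (.node (.seq (.right _) (.seq (.left _) (.right _)))
    (.seq (.node (.left _) (.node (.seq (.right _) (.right _))
      (.seq (.right _) (.seq (.left _) (.left _))))) hp))⟩
  simp only [Data.size, Data.left, Data.right]
  omega

/-- Each step adds at most `Q` to the accumulator. The budget `W` reserves `Q` for every remaining
list entry, so it bounds the loop state throughout and each iteration costs at most `40 * W + 40 +
q.eval W`. Additive growth is essential: repeated multiplication by a constant could become
exponential. -/
theorem foldLoop_runs {h : α × σ × β → σ} {p : Prog} {q : Polynomial ℕ}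
    (hp : ∀ x, ∃ t, t ≤ q.eval (esize x) ∧ Runs p (enc x) (enc (h x)) t) (a : α)
    (I : σ → Prop) (Q W : ℕ) (l : List β)
    (hI : ∀ s, ∀ b ∈ l, I s → I (h (a, s, b)) ∧ esize (h (a, s, b)) ≤ esize s + Q)
    (s : σ) (hs : I s) (hW : esize a + esize l + esize s + l.length * Q + 2 ≤ W) :
    ∃ t, t ≤ (l.length + 1) * (40 * W + 40 + q.eval W) ∧
      Runs (.loop (.seq .right .left) (foldBody p)) (.node (enc a) (.node (enc l) (enc s)))
        (.node (enc a) (.node .nil (enc (l.foldl (fun s b => h (a, s, b)) s)))) t := by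
  induction l generalizing s with
  | nil =>
    refine ⟨_, ?_, .loop_done (.seq (.right _) (.left _))⟩
    have e : enc ([] : List β) = .nil := rfl
    simp only [esize, e, Data.size, Data.right, List.length_nil] at *
    omega
  | cons b l ih =>
    obtain ⟨h1, h2⟩ := hI s b (by simp) hs
    simp only [esize_cons, List.length_cons, add_mul, one_mul] at hW
    obtain ⟨u, hu, hru⟩ := ih (fun s b hb => hI s b (by simp [hb])) _ h1 (by omega)
    obtain ⟨t, ht, hrt⟩ := hp (a, s, b)
    obtain ⟨t', ht', hrt'⟩ := foldBody_runs (R := enc l) hrt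
    refine ⟨_, ?_, .loop_step (.seq (.right _) (.left _)) hrt' hru⟩
    have hm : q.eval (esize (a, s, b)) ≤ q.eval W :=
      polynomial_eval_mono q (by simp only [esize_pair]; omega)
    rw [List.length_cons, add_mul (l.length + 1), one_mul]
    simp only [enc_cons, Data.size, Data.right] at *
    simp only [esize] at *
    omega

/-- Folding a list, if an invariant keeps the accumulator small. -/
theorem foldl_of_invariant {f : α → List β} {g : α → σ} {h : α × σ × β → σ} (hf : PolyTime f)
    (hg : PolyTime g) (hh : PolyTime h) (I : α → σ → Prop) (Q : Polynomial ℕ)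
    (h0 : ∀ a, I a (g a))
    (hI : ∀ a s, ∀ b ∈ f a, I a s →
      I a (h (a, s, b)) ∧ esize (h (a, s, b)) ≤ esize s + Q.eval (esize a)) :
    PolyTime fun a => (f a).foldl (fun s b => h (a, s, b)) (g a) := by
  obtain ⟨pf, qf, hf⟩ := hf
  obtain ⟨pg, qg, hg⟩ := hg
  obtain ⟨ph, qh, hh⟩ := hh
  -- `W` bounds every loop state, since `qf` bounds both the size and the length of the list; `T`
  -- bounds the time of the loop.
  let W : Polynomial ℕ := Polynomial.X + qf + qg + qf * Q + 2
  let T : Polynomial ℕ := (qf + 1) * (40 * W + 40 + qh.comp W)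
  -- The factor 3 pays for the loop and for the two final projections, whose inputs are no larger
  -- than the loop's running time.
  refine ⟨.seq (.node .id (.node pf pg)) (.seq (.loop (.seq .right .left) (foldBody ph))
    (.seq .right .right)), Polynomial.X + qf + qg + 3 * T + 20, fun a => ?_⟩
  obtain ⟨tf, htf, hrf⟩ := hf a
  obtain ⟨tg, htg, hrg⟩ := hg a
  have hlen : (f a).length < qf.eval (esize a) :=
    (length_lt_esize _).trans_le (hrf.size_le.2.trans htf)
  have hW : esize a + esize (f a) + esize (g a) + (f a).length * Q.eval (esize a) + 2
      ≤ W.eval (esize a) := by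
    have h1 : esize (f a) ≤ qf.eval (esize a) := hrf.size_le.2.trans htf
    have h2 : esize (g a) ≤ qg.eval (esize a) := hrg.size_le.2.trans htg
    have h3 := Nat.mul_le_mul_right (Q.eval (esize a)) hlen.le
    simp only [W, Polynomial.eval_add, Polynomial.eval_mul, Polynomial.eval_X,
      Polynomial.eval_ofNat]
    omega
  obtain ⟨t, ht, hr⟩ := foldLoop_runs hh a (I a) (Q.eval (esize a)) (W.eval (esize a)) (f a)
    (hI a) (g a) (h0 a) hW
  have hT : t ≤ T.eval (esize a) := by
    refine ht.trans ?_
    simp only [T, Polynomial.eval_add, Polynomial.eval_mul, Polynomial.eval_comp,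
      Polynomial.eval_ofNat, Polynomial.eval_one]
    exact Nat.mul_le_mul_right _ (by omega)
  refine ⟨_, ?_, .seq (.node (.id _) (.node hrf hrg)) (.seq hr (.seq (.right _) (.right _)))⟩
  have := hr.size_le.2
  simp only [Data.size, Data.right, Polynomial.eval_add, Polynomial.eval_mul, Polynomial.eval_X,
    Polynomial.eval_ofNat] at *
  simp only [esize] at *
  omega

theorem foldl {f : α → List β} {g : α → σ} {h : α × σ × β → σ} (hf : PolyTime f)
    (hg : PolyTime g) (hh : PolyTime h) (Q : Polynomial ℕ)
    (hQ : ∀ a s, ∀ b ∈ f a, esize (h (a, s, b)) ≤ esize s + Q.eval (esize a)) :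
    PolyTime fun a => (f a).foldl (fun s b => h (a, s, b)) (g a) :=
  foldl_of_invariant hf hg hh (fun _ _ => True) Q (fun _ => trivial)
    fun a s b hb _ => ⟨trivial, hQ a s b hb⟩

/-! ### List operations as folds -/

theorem reverseAppend {f g : α → List β} (hf : PolyTime f) (hg : PolyTime g) :
    PolyTime fun a => (f a).reverse ++ g a := by
  obtain ⟨q, hq⟩ := hf.exists_esize_le
  have := foldl (h := fun x : α × List β × β => x.2.2 :: x.2.1) hf hg
    ((snd.comp snd).cons (fst.comp snd)) q fun a s b hb => by
      have := esize_lt_of_mem hb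
      have := hq a
      dsimp only
      rw [esize_cons]; omega
  convert this using 2 with a
  simp

theorem reverse {f : α → List β} (hf : PolyTime f) : PolyTime fun a => (f a).reverse := by
  simpa using hf.reverseAppend (const [])

theorem append {f g : α → List β} (hf : PolyTime f) (hg : PolyTime g) :
    PolyTime fun a => f a ++ g a := by
  simpa using hf.reverse.reverseAppend hg

theorem map {f : α → List β} {g : α × β → γ} (hf : PolyTime f) (hg : PolyTime g) :
    PolyTime fun a => (f a).map fun b => g (a, b) := by
  obtain ⟨q, hq⟩ := hf.exists_esize_le
  obtain ⟨q', hq'⟩ := hg.exists_esize_le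
  have := foldl (h := fun x : α × List γ × β => g (x.1, x.2.2) :: x.2.1) hf (const [])
    ((hg.comp (fst.pair (snd.comp snd))).cons (fst.comp snd))
    (q'.comp (Polynomial.X + q + 1) + 1) fun a s b hb => by
      have h1 := esize_lt_of_mem hb
      have h2 := hq a
      have h3 := hq' (a, b)
      have h4 : q'.eval (esize (a, b)) ≤ q'.eval (esize a + q.eval (esize a) + 1) :=
        polynomial_eval_mono q' (by rw [esize_pair]; omega)
      simp only [esize_cons, Polynomial.eval_add, Polynomial.eval_comp, Polynomial.eval_X,
        Polynomial.eval_one]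
      omega
  convert this.reverse using 2 with a
  have : ∀ (l : List β) (s : List γ),
      l.foldl (fun s b => g (a, b) :: s) s = (l.map fun b => g (a, b)).reverse ++ s := by
    intro l
    induction l with
    | nil => simp
    | cons b l ih => intro s; simp [ih]
  simp [this]

theorem esize_append (l m : List β) : esize (l ++ m) + 1 = esize l + esize m := by
  induction l with
  | nil => simp [esize_nil]; omega
  | cons b l ih => simp only [List.cons_append, esize_cons]; omega

/-- Folding over the reversed list lets each block be put in front; by `esize_append` the
accumulator grows by less than the size of that block. -/
theorem flatten {f : α → List (List β)} (hf : PolyTime f) :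
    PolyTime fun a => (f a).flatten := by
  obtain ⟨q, hq⟩ := hf.exists_esize_le
  have := foldl (h := fun x : α × List β × List β => x.2.2 ++ x.2.1) hf.reverse (const [])
    ((snd.comp snd).append (fst.comp snd)) q fun a s b hb => by
      have h1 := esize_lt_of_mem (List.mem_reverse.1 hb)
      have h2 := hq a
      have h3 := esize_append b s
      dsimp only
      omega
  convert this using 2 with a
  have : ∀ (l : List (List β)) (s : List β),
      l.foldr (fun b s => b ++ s) s = l.flatten ++ s := by
    intro l
    induction l with
    | nil => simp
    | cons b l ih => intro s; simp [ih]
  simp [this]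

theorem flatMap {f : α → List β} {g : α × β → List γ} (hf : PolyTime f) (hg : PolyTime g) :
    PolyTime fun a => (f a).flatMap fun b => g (a, b) := by
  simpa [List.flatMap] using (hf.map hg).flatten

theorem any {f : α → List β} {g : α × β → Bool} (hf : PolyTime f) (hg : PolyTime g) :
    PolyTime fun a => (f a).any fun b => g (a, b) := by
  have := foldl (h := fun x : α × Bool × β => x.2.1 || g (x.1, x.2.2)) hf (const false)
    ((fst.comp snd).or (hg.comp (fst.pair (snd.comp snd)))) 3 fun a s b hb => by
      have := esize_bool_le (s || g (a, b))
      simp only [Polynomial.eval_ofNat]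
      omega
  convert this using 2 with a
  have : ∀ (l : List β) (s : Bool),
      l.foldl (fun s b => s || g (a, b)) s = (s || l.any fun b => g (a, b)) := by
    intro l
    induction l with
    | nil => simp
    | cons b l ih => intro s; simp [ih, Bool.or_assoc]
  simp [this]

/-! ### Unary arithmetic -/

theorem length {f : α → List β} (hf : PolyTime f) : PolyTime fun a => (f a).length := by
  -- A list of units and its length in unary are the same tree. Read backwards, this lets a number
  -- drive a fold.
  have : PolyTime (List.length : List Unit → ℕ) := recode fun l => by
    induction l with
    | nil => rfl
    | cons b l ih => exact congrArg _ ih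
  simpa using this.comp (hf.map (const ()))

theorem replicate_unit {f : α → ℕ} (hf : PolyTime f) :
    PolyTime fun a => List.replicate (f a) () := by
  refine comp (g := fun n => List.replicate n ()) (recode fun n => ?_) hf
  induction n with
  | zero => rfl
  | succ n ih => exact congrArg _ ih

/-- Decrementing `g a` exactly `f a` times gives the truncated difference, which is positive
precisely when the inequality holds. -/
theorem lt {f g : α → ℕ} (hf : PolyTime f) (hg : PolyTime g) :
    PolyTime fun a => decide (f a < g a) := by
  have := foldl (h := fun x : α × ℕ × Unit => x.2.1 - 1) hf.replicate_unit hg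
    (fst.comp snd).pred 0 fun a s b hb => by
      simp only [esize_nat, Polynomial.eval_zero]
      omega
  convert this.nat_pos using 3 with a
  have : ∀ n m : ℕ, (List.replicate n ()).foldl (fun s _ => s - 1) m = m - n := by
    intro n
    induction n with
    | zero => simp
    | succ n ih => intro m; simp only [List.replicate_succ, List.foldl_cons, ih]; omega
  simp [this]

theorem le {f g : α → ℕ} (hf : PolyTime f) (hg : PolyTime g) :
    PolyTime fun a => decide (f a ≤ g a) := by
  simpa [Nat.lt_succ_iff] using hf.lt hg.succ

theorem eq {f g : α → ℕ} (hf : PolyTime f) (hg : PolyTime g) :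
    PolyTime fun a => decide (f a = g a) := by
  convert (hf.le hg).and (hg.le hf) using 2 with a
  simp [le_antisymm_iff]

/-- A counter runs down from `f a` and each value is prepended. The invariant that the counter stays
below `f a` is what bounds the size of a new entry. -/
theorem range {f : α → ℕ} (hf : PolyTime f) : PolyTime fun a => List.range (f a) := by
  obtain ⟨q, hq⟩ := hf.exists_esize_le
  have hp : PolyTime fun x : α × (ℕ × List ℕ) × Unit => x.2.1.1 - 1 :=
    (fst.comp (fst.comp snd)).pred
  have := foldl_of_invariant
    (h := fun x : α × (ℕ × List ℕ) × Unit => (x.2.1.1 - 1, (x.2.1.1 - 1) :: x.2.1.2))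
    hf.replicate_unit (hf.pair (const [])) (hp.pair (hp.cons (snd.comp (fst.comp snd))))
    (fun a s => s.1 ≤ f a) (q + 1) (fun _ => le_rfl) fun a s b hb hs => by
      have := hq a
      simp only [esize_pair, esize_cons, esize_nat, Polynomial.eval_add, Polynomial.eval_one] at *
      have : esize s = 2 * s.1 + 1 + esize s.2 + 1 := by rw [← esize_nat]; rfl
      omega
  convert snd.comp this using 2 with a
  have : ∀ (n : ℕ) (l : List ℕ),
      ((List.replicate n ()).foldl (fun s _ => (s.1 - 1, (s.1 - 1) :: s.2)) (n, l)).2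
        = List.range n ++ l := by
    intro n
    induction n with
    | zero => simp
    | succ n ih => intro l; simp [List.replicate_succ, ih, List.range_succ]
  simp [this]

end PolyTime


/-! ## Planning instances that express covering problems -/

/-- The planning instance whose actions are the members of `T` and whose variables are the tests in
`cols`: an action makes true the variables of the tests that it passes, and all variables have to
become true. -/
def coverSAS {α : Type} (T : List α) (cols : List (α → Bool)) :
    SASPlus (Fin cols.length) (Fin 2) (Fin T.length) where
  pre := fun _ _ => none
  eff := fun a v => if cols.get v (T.get a) then some 1 else none
  init := fun _ => 0
  goal := fun _ => some 1

/-- Actions are always valid and never write anything but 1, so a final value depends only on which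
actions occur. -/
theorem coverSAS_isPlanFrom {α : Type} (T : List α) (cols : List (α → Bool))
    (w : List (Fin T.length)) (s s' : Fin cols.length → Fin 2) :
    (coverSAS T cols).IsPlanFrom w s s' ↔
      ∀ v, s' v = if ∃ a ∈ w, cols.get v (T.get a) then 1 else s v := by
  induction w generalizing s with
  | nil =>
    simp only [SASPlus.IsPlanFrom, List.not_mem_nil, false_and, exists_false, if_false]
    exact ⟨fun h v => by rw [h], fun h => funext fun v => (h v).symm⟩
  | cons a w ih =>
    have hv : (coverSAS T cols).Valid a s := fun v => Or.inr rfl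
    simp only [SASPlus.IsPlanFrom, hv, true_and]
    refine (ih _).trans (forall_congr' fun v => ?_)
    have : (coverSAS T cols).result a s v = if cols.get v (T.get a) then 1 else s v := by
      simp only [SASPlus.result, coverSAS]
      split <;> rfl
    rw [this]
    simp only [List.mem_cons, exists_eq_or_imp]
    by_cases h : ∃ a ∈ w, cols.get v (T.get a)
    · rw [if_pos h, if_pos (Or.inr h)]
    · simp only [h, or_false, if_false]

theorem coverSAS_isPlan {α : Type} (T : List α) (cols : List (α → Bool))
    (w : List (Fin T.length)) :
    (coverSAS T cols).IsPlan w ↔ ∀ f ∈ cols, ∃ a ∈ w, f (T.get a) := by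
  constructor
  · rintro ⟨s, hg, hp⟩ f hf
    obtain ⟨i, rfl⟩ := List.mem_iff_get.1 hf
    have h1 := (coverSAS_isPlanFrom T cols w _ _).1 hp i
    have h2 : s i = 1 := by
      rcases hg i with h | h
      · exact (Option.some.inj h).symm
      · simp [coverSAS] at h
    by_contra hc
    rw [h2, if_neg hc] at h1
    simp [coverSAS] at h1
  · intro h
    refine ⟨fun _ => 1, fun v => Or.inl rfl, (coverSAS_isPlanFrom T cols w _ _).2 fun v => ?_⟩
    rw [if_pos (h _ (List.get_mem _ v))]

theorem coverSAS_exists_plan {α : Type} (T : List α) (cols : List (α → Bool)) (k : ℕ) :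
    (∃ w : List (Fin T.length), w.length ≤ k ∧ (coverSAS T cols).IsPlan w) ↔
      ∃ w : List α, w.length ≤ k ∧ (∀ a ∈ w, a ∈ T) ∧ ∀ f ∈ cols, ∃ a ∈ w, f a := by
  simp only [coverSAS_isPlan]
  constructor
  · rintro ⟨w, hw, hc⟩
    refine ⟨w.map T.get, by simpa using hw, ?_, fun f hf => ?_⟩
    · intro a ha
      obtain ⟨i, -, rfl⟩ := List.mem_map.1 ha
      exact List.get_mem _ i
    · obtain ⟨a, ha, h⟩ := hc f hf
      exact ⟨_, List.mem_map_of_mem ha, h⟩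
  · rintro ⟨w, hw, hT, hc⟩
    have : ∃ w' : List (Fin T.length), w'.map T.get = w := by
      clear hw hc
      induction w with
      | nil => exact ⟨[], rfl⟩
      | cons a w ih =>
        obtain ⟨w', rfl⟩ := ih fun a ha => hT a (by simp [ha])
        obtain ⟨i, rfl⟩ := List.mem_iff_get.1 (hT a (by simp))
        exact ⟨i :: w', rfl⟩
    obtain ⟨w', rfl⟩ := this
    refine ⟨w', by simpa using hw, fun f hf => ?_⟩
    obtain ⟨a, ha, h⟩ := hc f hf
    obtain ⟨i, hi, rfl⟩ := List.mem_map.1 ha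
    exact ⟨i, hi, h⟩

/-! ## Weighted satisfiability as a covering problem

A set of `k` variables among `0, …, n - 1` is given by the `k + 1` intervals between its members:
the triple `(r, u, v)` says that the variables `u, …, v - 1` form the `r`-th interval, so that `v` is
the `r`-th member of the set if `r < k`, and `v = n` if `r = k`. -/

/-- All triples `(r, u, v)` with `r ≤ k` and `u, v ≤ n`. -/
def gapTriples (k n : ℕ) : List (ℕ × ℕ × ℕ) :=
  (List.range (k + 1)).flatMap fun r => (List.range (n + 1)).flatMap fun u =>
    (List.range (n + 1)).map fun v => (r, u, v)

/-- The triple is a possible interval number `r`. -/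
def slotTest (k n r : ℕ) (x : ℕ × ℕ × ℕ) : Bool :=
  decide (x.1 = r) && decide (x.2.1 ≤ x.2.2) && (decide (0 < r) || decide (x.2.1 = 0)) &&
    bif decide (r = k) then decide (x.2.2 = n) else decide (x.2.2 < n)

/-- The triple is an interval number `r` that does not end at `i`, or an interval number `r + 1`
that begins after `i`. -/
def linkTest (r i : ℕ) (x : ℕ × ℕ × ℕ) : Bool :=
  decide (x.1 = r) && !decide (x.2.2 = i) || decide (x.1 = r + 1) && decide (x.2.1 = i + 1)

/-- The interval makes one of the literals true. -/
def clauseTest (c : List (ℕ × Bool)) (x : ℕ × ℕ × ℕ) : Bool :=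
  c.any fun l => bif l.2 then decide (x.2.2 = l.1) else
    decide (x.2.1 ≤ l.1) && decide (l.1 < x.2.2)

/-- The tests of the covering problem. -/
def gapTests (k n : ℕ) (cs : List (List (ℕ × Bool))) : List (ℕ × ℕ × ℕ → Bool) :=
  (List.range (k + 1)).map (slotTest k n) ++
    ((List.range k).flatMap fun r => (List.range n).map (linkTest r)) ++ cs.map clauseTest

theorem mem_gapTriples {k n r u v : ℕ} :
    (r, u, v) ∈ gapTriples k n ↔ r ≤ k ∧ u ≤ n ∧ v ≤ n := by
  simp [gapTriples]

theorem forall_mem_gapTests {k n : ℕ} {cs : List (List (ℕ × Bool))}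
    {p : (ℕ × ℕ × ℕ → Bool) → Prop} :
    (∀ f ∈ gapTests k n cs, p f) ↔ (∀ r ≤ k, p (slotTest k n r)) ∧
      (∀ r < k, ∀ i < n, p (linkTest r i)) ∧ ∀ c ∈ cs, p (clauseTest c) := by
  simp only [gapTests, List.mem_append, List.mem_map, List.mem_flatMap, List.mem_range,
    Nat.lt_succ_iff]
  constructor
  · intro h
    exact ⟨fun r hr => h _ (.inl (.inl ⟨r, hr, rfl⟩)),
      fun r hr i hi => h _ (.inl (.inr ⟨r, hr, i, hi, rfl⟩)), fun c hc => h _ (.inr ⟨c, hc, rfl⟩)⟩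
  · rintro ⟨h1, h2, h3⟩ f ((⟨r, hr, rfl⟩ | ⟨r, hr, i, hi, rfl⟩) | ⟨c, hc, rfl⟩)
    exacts [h1 r hr, h2 r hr i hi, h3 c hc]

theorem slotTest_iff {k n r s u v : ℕ} : slotTest k n r (s, u, v) ↔
    s = r ∧ u ≤ v ∧ (r = 0 → u = 0) ∧ (r = k → v = n) ∧ (r ≠ k → v < n) := by
  by_cases h : r = k <;> simp [slotTest, h, Nat.pos_iff_ne_zero, or_iff_not_imp_left, and_assoc]

theorem linkTest_iff {r i s u v : ℕ} : linkTest r i (s, u, v) ↔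
    s = r ∧ v ≠ i ∨ s = r + 1 ∧ u = i + 1 := by
  simp [linkTest]

theorem clauseTest_iff {c : List (ℕ × Bool)} {s u v : ℕ} : clauseTest c (s, u, v) ↔
    ∃ l ∈ c, l.2 = true ∧ v = l.1 ∨ l.2 = false ∧ u ≤ l.1 ∧ l.1 < v := by
  simp only [clauseTest, List.any_eq_true]
  refine exists_congr fun l => and_congr_right fun _ => ?_
  cases l.2 <;> simp

/-- A sorted enumeration of a set satisfying the clauses gives a cover. -/
theorem exists_cover {k n : ℕ} {cs : List (List (ℕ × Bool))} {m : ℕ → ℕ}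
    (hm : ∀ r < k, m r < n) (hmono : ∀ r s, r < s → s < k → m r < m s)
    (hs : ∀ c ∈ cs, ∃ l ∈ c, l.1 < n ∧ ((∃ r < k, m r = l.1) ↔ l.2 = true)) :
    ∃ w : List (ℕ × ℕ × ℕ), w.length ≤ k + 1 ∧ (∀ a ∈ w, a ∈ gapTriples k n) ∧
      ∀ f ∈ gapTests k n cs, ∃ a ∈ w, f a := by
  -- Gap `r` is `[u r, v r)`: it ends at the `r`-th member, or at the sentinel `n` when `r = k`, and
  -- begins one past the previous member, or at 0.
  let v : ℕ → ℕ := fun r => if r < k then m r else n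
  let u : ℕ → ℕ := fun r => if r = 0 then 0 else v (r - 1) + 1
  have hv : ∀ r < k, v r = m r := fun r hr => if_pos hr
  have hvk : v k = n := if_neg (lt_irrefl k)
  have hu0 : u 0 = 0 := if_pos rfl
  have hus : ∀ r, u (r + 1) = v r + 1 := fun r => if_neg r.succ_ne_zero
  have hvlt : ∀ r < k, v r < n := fun r hr => hv r hr ▸ hm r hr
  have hvn : ∀ r, v r ≤ n := fun r => by
    by_cases h : r < k
    · exact (hvlt r h).le
    · exact (if_neg h).le
  have hstep : ∀ r < k, v r < v (r + 1) := fun r hr => by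
    rcases Nat.lt_or_eq_of_le (Nat.succ_le_of_lt hr) with h | h
    · rw [hv r hr, hv _ h]; exact hmono r _ (Nat.lt_succ_self r) h
    · rw [show r + 1 = k from h, hvk]; exact hvlt r hr
  have huv : ∀ r ≤ k, u r ≤ v r := fun r hr => by
    cases r with
    | zero => simp [hu0]
    | succ r => rw [hus]; exact hstep r hr
  have hmem : ∀ r ≤ k, (r, u r, v r) ∈ (List.range (k + 1)).map fun r => (r, u r, v r) :=
    fun r hr => List.mem_map.2 ⟨r, by simpa [Nat.lt_succ_iff] using hr, rfl⟩
  refine ⟨(List.range (k + 1)).map fun r => (r, u r, v r), by simp, ?_, ?_⟩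
  · intro a ha
    obtain ⟨r, hr, rfl⟩ := List.mem_map.1 ha
    have hr : r ≤ k := by simpa [Nat.lt_succ_iff] using hr
    exact mem_gapTriples.2 ⟨hr, (huv r hr).trans (hvn r), hvn r⟩
  · refine forall_mem_gapTests.2 ⟨fun r hr => ?_, fun r hr i hi => ?_, fun c hc => ?_⟩
    · refine ⟨_, hmem r hr, slotTest_iff.2 ⟨rfl, huv r hr, ?_, ?_, ?_⟩⟩
      · rintro rfl; exact hu0
      · rintro rfl; exact hvk
      · exact fun h => hvlt r (lt_of_le_of_ne hr h)
    -- Gap `r` passes the link test unless it ends at `i`; then gap `r + 1` begins at `i + 1` and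
    -- passes instead.
    · by_cases h : v r = i
      · exact ⟨_, hmem (r + 1) hr, linkTest_iff.2 (.inr ⟨rfl, by rw [hus, h]⟩)⟩
      · exact ⟨_, hmem r hr.le, linkTest_iff.2 (.inl ⟨rfl, h⟩)⟩
    · obtain ⟨l, hl, hln, h⟩ := hs c hc
      cases hb : l.2 with
      | true =>
        obtain ⟨r, hr, e⟩ := h.2 hb
        exact ⟨_, hmem r hr.le, clauseTest_iff.2 ⟨l, hl, .inl ⟨hb, (hv r hr).trans e⟩⟩⟩
      | false =>
        have hne : ∀ r < k, v r ≠ l.1 := fun r hr e => by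
          have := h.1 ⟨r, hr, by rw [← hv r hr, e]⟩
          simp [hb] at this
        -- The gap around a false variable is the first one whose end lies beyond it. The previous
        -- end is at most the variable and, the variable being false, different from it, so the gap
        -- begins no later than the variable.
        have hex : ∃ r, l.1 < v r := ⟨k, by rw [hvk]; exact hln⟩
        classical
        have hle : Nat.find hex ≤ k := Nat.find_min' hex (by rw [hvk]; exact hln)
        refine ⟨_, hmem _ hle, clauseTest_iff.2 ⟨l, hl, .inr ⟨hb, ?_, Nat.find_spec hex⟩⟩⟩
        rcases hr : Nat.find hex with - | r
        · simp [hu0]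
        · have h1 := Nat.find_min hex (m := r) (by omega)
          have h2 := hne r (by omega)
          rw [hus]
          omega

/-- A cover gives a sorted enumeration of a set satisfying the clauses. -/
theorem exists_of_cover {k n : ℕ} {cs : List (List (ℕ × Bool))}
    (hcs : ∀ c ∈ cs, ∀ l ∈ c, l.1 < n) {w : List (ℕ × ℕ × ℕ)} (hw : w.length ≤ k + 1)
    (hc : ∀ f ∈ gapTests k n cs, ∃ a ∈ w, f a) :
    ∃ m : ℕ → ℕ, (∀ r < k, m r < n) ∧ (∀ r s, r < s → s < k → m r < m s) ∧
      ∀ c ∈ cs, ∃ l ∈ c, (∃ r < k, m r = l.1) ↔ l.2 = true := by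
  obtain ⟨h1, h2, h3⟩ := forall_mem_gapTests.1 hc
  have hex : ∀ r, ∃ u v : ℕ, r ≤ k → (r, u, v) ∈ w ∧ slotTest k n r (r, u, v) := by
    intro r
    by_cases hr : r ≤ k
    · obtain ⟨⟨s, u, v⟩, hm, hs⟩ := h1 r hr
      obtain rfl := (slotTest_iff.1 hs).1
      exact ⟨u, v, fun _ => ⟨hm, hs⟩⟩
    · exact ⟨0, 0, fun h => absurd h hr⟩
  choose u v huv using hex
  -- Pigeonhole: the `k + 1` slots need distinct triples and `w` has room for no more, so `w`
  -- contains nothing else.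
  have hall : ∀ a ∈ w, ∃ r ≤ k, a = (r, u r, v r) := by
    have hinj : Function.Injective fun r => (r, u r, v r) := fun r s h => congrArg Prod.fst h
    have hsub : (Finset.range (k + 1)).image (fun r => (r, u r, v r)) ⊆ w.toFinset := by
      intro a ha
      obtain ⟨r, hr, rfl⟩ := Finset.mem_image.1 ha
      exact List.mem_toFinset.2 (huv r (by simpa [Nat.lt_succ_iff] using hr)).1
    have heq := Finset.eq_of_subset_of_card_le hsub (by
      rw [Finset.card_image_of_injective _ hinj, Finset.card_range]
      exact (List.toFinset_card_le w).trans hw)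
    intro a ha
    obtain ⟨r, hr, h⟩ := Finset.mem_image.1 (heq ▸ List.mem_toFinset.2 ha)
    exact ⟨r, by simpa [Nat.lt_succ_iff] using hr, h.symm⟩
  have hslot := fun r hr => slotTest_iff.1 (huv r hr).2
  have hvn : ∀ r < k, v r < n := fun r hr => (hslot r hr.le).2.2.2.2 hr.ne
  have hlink : ∀ r < k, u (r + 1) = v r + 1 := by
    intro r hr
    -- Taking `i = v r` makes gap `r` fail its link test, so only gap `r + 1` can cover it.
    obtain ⟨a, ha, hl⟩ := h2 r hr (v r) (hvn r hr)
    obtain ⟨s, hs, rfl⟩ := hall a ha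
    rcases linkTest_iff.1 hl with ⟨rfl, h⟩ | ⟨rfl, h⟩
    · exact absurd rfl h
    · exact h
  have hstep : ∀ r < k, v r < v (r + 1) := fun r hr => by
    have := (hslot (r + 1) hr).2.1
    have := hlink r hr
    omega
  have hmono : ∀ r s, r < s → s ≤ k → v r < v s := by
    intro r s hrs hs
    induction s, hrs using Nat.le_induction with
    | base => exact hstep r hs
    | succ s hrs ih => exact (ih (by omega)).trans (hstep s hs)
  refine ⟨v, hvn, fun r s h hs => hmono r s h hs.le, fun c hcc => ?_⟩
  obtain ⟨a, ha, hct⟩ := h3 c hcc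
  obtain ⟨r, hr, rfl⟩ := hall a ha
  obtain ⟨l, hl, h⟩ := clauseTest_iff.1 hct
  refine ⟨l, hl, ?_⟩
  rcases h with ⟨hb, e⟩ | ⟨hb, hle, hlt⟩
  · simp only [hb, iff_true]
    refine ⟨r, lt_of_le_of_ne hr ?_, e⟩
    -- The last gap ends at `n`, which is not a variable, so it cannot witness a positive literal.
    rintro rfl
    have := (hslot r le_rfl).2.2.2.1 rfl
    have := hcs c hcc l hl
    omega
  · simp only [hb, Bool.false_eq_true, iff_false]
    rintro ⟨s, hs, e⟩
    -- Members numbered below `r` lie before `u r`, the others are at least `v r`; none lies inside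
    -- gap `r`.
    rcases lt_or_ge s r with h | h
    · have h4 := hlink s hs
      rcases Nat.lt_or_eq_of_le (Nat.succ_le_of_lt h) with h' | h'
      · obtain ⟨r', rfl⟩ : ∃ r', r = r' + 1 := ⟨r - 1, by omega⟩
        have := hlink r' (by omega)
        have := hmono s r' (by omega) (by omega)
        omega
      · have h' : s + 1 = r := h'
        rw [h'] at h4
        omega
    · rcases h.eq_or_lt with rfl | h
      · omega
      · have := hmono r s h hs.le
        omega

/-- The clauses with variables replaced by numbers. -/
def WSatInst.natClauses (x : WSatInst) : List (List (ℕ × Bool)) :=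
  x.clauses.map (List.map fun l => (l.1.val, l.2))

/-- Increasing enumerations of length `k` correspond to sets of cardinality exactly `k`; strict
monotonicity supplies the injectivity needed for the count. -/
theorem WSatInst.yes_iff (x : WSatInst) : x.Yes ↔
    ∃ w : List (ℕ × ℕ × ℕ), w.length ≤ x.k + 1 ∧ (∀ a ∈ w, a ∈ gapTriples x.k x.numVars) ∧
      ∀ f ∈ gapTests x.k x.numVars x.natClauses, ∃ a ∈ w, f a := by
  constructor
  · rintro ⟨T, hT, hc⟩
    let e := T.orderEmbOfFin hT
    let m : ℕ → ℕ := fun r => if h : r < x.k then (e ⟨r, h⟩).val else 0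
    have hm : ∀ r (h : r < x.k), m r = (e ⟨r, h⟩).val := fun r h => dif_pos h
    refine exists_cover (m := m) (fun r hr => ?_) (fun r s hrs hs => ?_) fun c hcc => ?_
    · rw [hm r hr]; exact (e _).2
    · rw [hm r (hrs.trans hs), hm s hs]
      exact e.strictMono (show (⟨r, hrs.trans hs⟩ : Fin x.k) < ⟨s, hs⟩ from hrs)
    · obtain ⟨c, hc', rfl⟩ := List.mem_map.1 hcc
      obtain ⟨l, hl, h⟩ := hc c hc'
      refine ⟨_, List.mem_map_of_mem hl, l.1.2, ?_⟩
      rw [← h]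
      constructor
      · rintro ⟨r, hr, h'⟩
        rw [hm r hr] at h'
        rw [← Fin.ext h']
        exact T.orderEmbOfFin_mem hT _
      · intro hlT
        obtain ⟨r, hr⟩ : l.1 ∈ Set.range e := by
          rw [Finset.range_orderEmbOfFin]; exact hlT
        exact ⟨r, r.2, by rw [hm r r.2, ← hr]⟩
  · rintro ⟨w, hw, -, hc⟩
    obtain ⟨m, hm, hmono, hs⟩ := exists_of_cover (fun c hc l hl => by
      obtain ⟨c, -, rfl⟩ := List.mem_map.1 hc
      obtain ⟨l, -, rfl⟩ := List.mem_map.1 hl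
      exact l.1.2) hw hc
    let e : Fin x.k → Fin x.numVars := fun r => ⟨m r, hm r r.2⟩
    have he : StrictMono e := fun r s h => hmono r s h s.2
    refine ⟨Finset.univ.map ⟨e, he.injective⟩, by simp, fun c hcc => ?_⟩
    obtain ⟨l', hl', h⟩ := hs _ (List.mem_map_of_mem hcc)
    obtain ⟨l, hl, rfl⟩ := List.mem_map.1 hl'
    refine ⟨l, hl, Iff.trans ?_ h⟩
    simp only [Finset.mem_map, Finset.mem_univ, true_and, Function.Embedding.coeFn_mk]
    constructor
    · rintro ⟨r, hr⟩
      exact ⟨r, r.2, congrArg Fin.val hr⟩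
    · rintro ⟨r, hr, heq⟩
      exact ⟨⟨r, hr⟩, Fin.ext heq⟩


/-! ## The reduction runs in polynomial time -/

/-- The instance of bounded planning that expresses an instance of weighted satisfiability. -/
def gapInst (x : WSatInst) : PlanInst where
  numVars := (gapTests x.k x.numVars x.natClauses).length
  numVals := 2
  numActs := (gapTriples x.k x.numVars).length
  sas := coverSAS (gapTriples x.k x.numVars) (gapTests x.k x.numVars x.natClauses)
  -- One action per gap; the bound is positive even for weight 0.
  k := x.k + 1
  k_pos := x.k.succ_pos

/-! ### The tree of the constructed instance -/

theorem encList_map {α β : Type} (e : β → Data) (f : α → β) (l : List α) :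
    encList e (l.map f) = encList (fun a => e (f a)) l := by
  induction l with
  | nil => rfl
  | cons a l ih => simp [encList, ih]

theorem encTuple_get {α β : Type} (e : β → Data) (l : List α) (g : α → β) :
    encTuple e (fun i : Fin l.length => g (l.get i)) = encList e (l.map g) := by
  rw [encTuple]
  congr 1
  apply List.ext_get <;> simp

/-- The tree of the planning instance of a covering problem, as an encoded tuple of lists. -/
def coverCode {α : Type} (T : List α) (cols : List (α → Bool)) (k : ℕ) :
    (ℕ × ℕ × List (List (Option ℕ)) × List (List (Option ℕ)) × List ℕ × List (Option ℕ)) × ℕ :=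
  ((cols.length, 2, T.map fun _ => cols.map fun _ => none,
    T.map fun a => cols.map fun f => bif f a then some 1 else none,
    cols.map fun _ => 0, cols.map fun _ => some 1), k + 1)

/-- The encoding of `Fin` forgets its bound, and a tuple indexed by the positions of a list is
encoded as a mapped list. The dependent types thus disappear and the `PolyTime` combinators apply.
-/
theorem enc_gapInst (x : WSatInst) : Data.node (gapInst x).enc (encNat (gapInst x).k) =
    enc (coverCode (gapTriples x.k x.numVars) (gapTests x.k x.numVars x.natClauses) x.k) := by
  simp only [coverCode, gapInst, PlanInst.enc, coverSAS, TreeEnc.enc]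
  generalize gapTests x.k x.numVars x.natClauses = cols
  generalize gapTriples x.k x.numVars = T
  have h0 : ∀ b : Option (Fin 2), encPartial (fun _ : Fin cols.length => b) =
      encList (encOption encNat) (cols.map fun _ => b.map Fin.val) := fun b => by
    rw [encPartial, encTuple_get _ cols fun _ => b, encList_map, encList_map]
    cases b <;> rfl
  have h1 : encList encPartial
      (List.ofFn fun (_ : Fin T.length) (_ : Fin cols.length) => (none : Option (Fin 2))) =
      encList (encList (encOption encNat)) (T.map fun _ => cols.map fun _ => none) := by
    have h := encTuple_get (encPartial (n := cols.length) (d := 2)) T fun _ _ => none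
    rw [encTuple] at h
    rw [h, encList_map, encList_map]
    exact congrArg (encList · T) (funext fun _ => h0 none)
  have h2 : encList encPartial (List.ofFn fun (a : Fin T.length) (v : Fin cols.length) =>
        if cols.get v (T.get a) then some (1 : Fin 2) else none) =
      encList (encList (encOption encNat))
        (T.map fun a => cols.map fun f => bif f a then some 1 else none) := by
    have h := encTuple_get (encPartial (n := cols.length) (d := 2)) T
      fun a v => if cols.get v a then some 1 else none
    rw [encTuple] at h
    rw [h, encList_map, encList_map]
    refine congrArg (encList · T) (funext fun a => ?_)
    have h := encTuple_get (encOption (encFin (n := 2))) cols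
      fun f => if f a then some 1 else none
    rw [encPartial, h, encList_map, encList_map]
    refine congrArg (encList · cols) (funext fun f => ?_)
    cases f a <;> rfl
  have h3 : encTuple encFin (fun _ : Fin cols.length => (0 : Fin 2)) =
      encList encNat (cols.map fun _ => 0) := by
    rw [encTuple_get _ cols fun _ => 0, encList_map, encList_map]
    rfl
  rw [h1, h2, h3, h0]
  rfl

namespace PolyTime

variable {α : Type} [TreeEnc α]

theorem gapTriples {k n : α → ℕ} (hk : PolyTime k) (hn : PolyTime n) :
    PolyTime fun a => ParamPlanning.gapTriples (k a) (n a) := by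
  have h3 : PolyTime fun x : (α × ℕ) × ℕ => (List.range (n x.1.1 + 1)).map fun v => (x.1.2, x.2, v) :=
    map (g := fun y : ((α × ℕ) × ℕ) × ℕ => (y.1.1.2, y.1.2, y.2))
      (hn.comp (fst.comp fst)).succ.range
      ((snd.comp (fst.comp fst)).pair ((snd.comp fst).pair snd))
  exact flatMap hk.succ.range (flatMap (hn.comp fst).succ.range h3)

theorem slotTest {k n r : α → ℕ} {x : α → ℕ × ℕ × ℕ} (hk : PolyTime k) (hn : PolyTime n)
    (hr : PolyTime r) (hx : PolyTime x) :
    PolyTime fun a => ParamPlanning.slotTest (k a) (n a) (r a) (x a) := by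
  have h1 := fst.comp hx
  have h2 := fst.comp (snd.comp hx)
  have h3 := snd.comp (snd.comp hx)
  exact (((h1.eq hr).and (h2.le h3)).and (((const 0).lt hr).or (h2.eq (const 0)))).and
    ((hr.eq hk).cond (h3.eq hn) (h3.lt hn))

theorem linkTest {r i : α → ℕ} {x : α → ℕ × ℕ × ℕ} (hr : PolyTime r) (hi : PolyTime i)
    (hx : PolyTime x) : PolyTime fun a => ParamPlanning.linkTest (r a) (i a) (x a) := by
  have h1 := fst.comp hx
  have h2 := fst.comp (snd.comp hx)
  have h3 := snd.comp (snd.comp hx)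
  exact ((h1.eq hr).and (h3.eq hi).not).or ((h1.eq hr.succ).and (h2.eq hi.succ))

theorem clauseTest {c : α → List (ℕ × Bool)} {x : α → ℕ × ℕ × ℕ} (hc : PolyTime c)
    (hx : PolyTime x) : PolyTime fun a => ParamPlanning.clauseTest (c a) (x a) := by
  have hx' : PolyTime fun y : α × ℕ × Bool => x y.1 := hx.comp fst
  have h2 := fst.comp (snd.comp hx')
  have h3 := snd.comp (snd.comp hx')
  have hl : PolyTime fun y : α × ℕ × Bool => y.2.1 := fst.comp snd
  have hb : PolyTime fun y : α × ℕ × Bool => y.2.2 := snd.comp snd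
  exact any hc (hb.cond (h3.eq hl) ((h2.le hl).and (hl.lt h3)))

/-- Tests are functions and have no encoding; only the list of their values at a given triple is
computed. -/
theorem gapTests {k n : α → ℕ} {cs : α → List (List (ℕ × Bool))} {x : α → ℕ × ℕ × ℕ}
    (hk : PolyTime k) (hn : PolyTime n) (hc : PolyTime cs) (hx : PolyTime x) :
    PolyTime fun a => (ParamPlanning.gapTests (k a) (n a) (cs a)).map fun f => f (x a) := by
  simp only [ParamPlanning.gapTests, List.map_append, List.map_map, List.map_flatMap,
    Function.comp_def]
  have h1 := map (g := fun y : α × ℕ => ParamPlanning.slotTest (k y.1) (n y.1) y.2 (x y.1))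
    hk.succ.range (slotTest (hk.comp fst) (hn.comp fst) snd (hx.comp fst))
  have h2 := map (g := fun y : (α × ℕ) × ℕ => ParamPlanning.linkTest y.1.2 y.2 (x y.1.1))
    (hn.comp fst).range (linkTest (snd.comp fst) snd (hx.comp (fst.comp fst)))
  have h3 := map (g := fun y : α × List (ℕ × Bool) => ParamPlanning.clauseTest y.2 (x y.1))
    hc (clauseTest snd (hx.comp fst))
  exact (h1.append (hk.range.flatMap h2)).append h3

/-- A function of the tests that depends on a test only through its value at a triple. -/
theorem mapGapTests {β : Type} [TreeEnc β] {k n : α → ℕ} {cs : α → List (List (ℕ × Bool))}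
    {x : α → ℕ × ℕ × ℕ} {g : Bool → β} (hk : PolyTime k) (hn : PolyTime n) (hc : PolyTime cs)
    (hx : PolyTime x) :
    PolyTime fun a => (ParamPlanning.gapTests (k a) (n a) (cs a)).map fun f => g (f (x a)) := by
  have := map (g := fun y : α × Bool => bif y.2 then g true else g false)
    (gapTests hk hn hc hx) (snd.cond (const _) (const _))
  convert this using 2 with a
  rw [List.map_map]
  refine List.map_congr_left fun f _ => ?_
  dsimp only [Function.comp]
  cases f (x a) <;> rfl

theorem coverCode {k n : α → ℕ} {cs : α → List (List (ℕ × Bool))}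
    (hk : PolyTime k) (hn : PolyTime n) (hc : PolyTime cs) :
    PolyTime fun a => ParamPlanning.coverCode (ParamPlanning.gapTriples (k a) (n a))
      (ParamPlanning.gapTests (k a) (n a) (cs a)) (k a) := by
  -- For constant entries the triple is irrelevant, and `(0, 0, 0)` serves as a dummy.
  have h : ∀ {β : Type} [TreeEnc β] (b : β),
      PolyTime fun a => (ParamPlanning.gapTests (k a) (n a) (cs a)).map fun _ => b :=
    fun b => mapGapTests (g := fun _ => b) hk hn hc (const (0, 0, 0))
  refine pair (pair ?_ (pair (const 2) (pair ?_ (pair ?_ (pair (h 0) (h (some 1))))))) hk.succ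
  · simpa using (h ()).length
  · exact map (gapTriples hk hn) ((h none).comp fst)
  · exact map (gapTriples hk hn) (mapGapTests (g := fun b => bif b then some 1 else none)
      (hk.comp fst) (hn.comp fst) (hc.comp fst) snd)

end PolyTime

/-- Replacing `Fin` by `ℕ` leaves the tree unchanged, so the program can start directly on the given
instance. -/
theorem WSatInst.enc_natClauses (x : WSatInst) :
    TreeEnc.enc ((x.numVars, x.natClauses), x.k) = weightedTwoNormalizedSat.code x := by
  change Data.node (.node (encNat x.numVars) (encList _ (List.map _ x.clauses))) _ =
    Data.node (.node (encNat x.numVars) (encList _ x.clauses)) (encNat x.k)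
  rw [encList_map]
  congr 3
  funext c
  exact encList_map _ _ c

/-! ## Parameterized reductions -/

/-- Bounds on the parameter and on time need not be monotone, so a value at an unknown `m ≤ g k` is
replaced by the sum of all values up to `g k`. -/
theorem exists_computable_bound {f g : ℕ → ℕ} (hf : Computable f) (hg : Computable g) :
    ∃ F : ℕ → ℕ, Computable F ∧ ∀ k, ∀ m ≤ g k, f m ≤ F k := by
  let S : ℕ → ℕ := fun n => Nat.rec 0 (fun m s => s + f m) n
  have hS : Computable S := Computable.nat_rec Computable.id (Computable.const 0)
    (Primrec.nat_add.to_comp.comp (Computable.snd.comp Computable.snd)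
      (hf.comp (Computable.fst.comp Computable.snd))).to₂
  refine ⟨fun k => S (g k + 1), hS.comp (Computable.succ.comp hg), fun k m hm => ?_⟩
  have : ∀ n, m < n → f m ≤ S n := by
    intro n hn
    induction n, hn using Nat.le_induction with
    | base => exact Nat.le_add_left _ _
    | succ n _ ih => exact ih.trans (Nat.le_add_right _ _)
  exact this _ (Nat.lt_succ_of_le hm)

theorem computable_mul_pow {f g : ℕ → ℕ} (hf : Computable f) (hg : Computable g) (c : ℕ) :
    Computable fun n => f n * g n ^ c := by
  induction c with
  | zero => simpa using hf
  | succ c ih => simpa [pow_succ, mul_assoc] using Primrec.nat_mul.to_comp.comp ih hg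

/-- The intermediate instance is no larger than the time spent producing it, so the second phase
takes at most `F k * (f k * n ^ c) ^ c'`. The exponent `c + c * c'` dominates both phases. -/
theorem FPTReduces.trans {L L' L'' : ParamProblem} (h : FPTReduces L L')
    (h' : FPTReduces L' L'') : FPTReduces L L'' := by
  obtain ⟨R, hR, ⟨g, hg, hgk⟩, p, f, c, hf, hp⟩ := h
  obtain ⟨R', hR', ⟨g', hg', hgk'⟩, p', f', c', hf', hp'⟩ := h'
  obtain ⟨G, hG, hGk⟩ := exists_computable_bound hg' hg
  obtain ⟨F, hF, hFk⟩ := exists_computable_bound hf' hg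
  refine ⟨fun x => R' (R x), fun x => (hR x).trans (hR' _),
    ⟨G, hG, fun x => (hgk' _).trans (hGk _ _ (hgk x))⟩, .seq p p',
    fun k => f k + F k * f k ^ c' + 1, c + c * c',
    Computable.succ.comp (Primrec.nat_add.to_comp.comp hf (computable_mul_pow hF hf c')),
    fun x => ?_⟩
  obtain ⟨t, ht, hr⟩ := hp x
  obtain ⟨t', ht', hr'⟩ := hp' (R x)
  refine ⟨_, ?_, .seq hr hr'⟩
  have hn : 0 < L.size x := Data.size_pos _
  have hsize : L'.size (R x) ≤ f (L.param x) * L.size x ^ c := hr.size_le.2.trans ht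
  have h1 : L.size x ^ c ≤ L.size x ^ (c + c * c') := Nat.pow_le_pow_right hn (Nat.le_add_right _ _)
  have h2 : L.size x ^ (c * c') ≤ L.size x ^ (c + c * c') :=
    Nat.pow_le_pow_right hn (Nat.le_add_left _ _)
  have h3 : t' ≤ F (L.param x) * f (L.param x) ^ c' * L.size x ^ (c * c') := by
    calc t' ≤ F (L.param x) * (f (L.param x) * L.size x ^ c) ^ c' :=
          ht'.trans (Nat.mul_le_mul (hFk _ _ (hgk x)) (Nat.pow_le_pow_left hsize c'))
      _ = _ := by rw [mul_pow, ← pow_mul, mul_assoc]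
  have h4 := Nat.mul_le_mul_left (f (L.param x)) h1
  have h5 := Nat.mul_le_mul_left (F (L.param x) * f (L.param x) ^ c') h2
  have h6 : 0 < L.size x ^ (c + c * c') := Nat.pow_pos hn
  simp only [add_mul, one_mul]
  omega

theorem w2Hard_of_fptReduces {L : ParamProblem} (h : FPTReduces weightedTwoNormalizedSat L) :
    W2Hard L := fun _ hL => FPTReduces.trans hL h

/-- Stated for any `Q` that the constructed instances satisfy, so that one reduction serves both
restrictions. -/
theorem fptReduces_boundedPlanning {Q : PlanInst → Prop} (hQ : ∀ x, Q (gapInst x)) :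
    FPTReduces weightedTwoNormalizedSat (boundedPlanning Q) := by
  obtain ⟨p, q, h⟩ := PolyTime.coverCode
    (α := (ℕ × List (List (ℕ × Bool))) × ℕ) (k := Prod.snd) (n := fun a => a.1.1)
    (cs := fun a => a.1.2) .snd (PolyTime.fst.comp .fst) (PolyTime.snd.comp .fst)
  refine ⟨fun x => ⟨gapInst x, hQ x⟩, fun x : WSatInst => ?_, ⟨fun k => k + 1, Computable.succ,
    fun x => le_rfl⟩, p, fun _ => q.eval 1, q.natDegree, Computable.const _, fun x : WSatInst => ?_⟩
  · exact x.yes_iff.trans (coverSAS_exists_plan _ _ _).symm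
  · obtain ⟨t, ht, hr⟩ := h ((x.numVars, x.natClauses), x.k)
    rw [x.enc_natClauses] at hr
    rw [esize, x.enc_natClauses] at ht
    refine ⟨t, ht.trans (polynomial_eval_le q (Data.size_pos _)), ?_⟩
    change Runs p _ (Data.node (gapInst x).enc (encNat (gapInst x).k)) t
    rw [enc_gapInst]
    exact hr

theorem gapInst_restrictionB (x : WSatInst) : (gapInst x).sas.RestrictionB :=
  Nat.card_fin 2

theorem gapInst_noPreconditions (x : WSatInst) : (gapInst x).sas.NoPreconditions :=
  fun _ _ => rfl

theorem SASPlus.NoPreconditions.restrictionS {V D A : Type} {P : SASPlus V D A}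
    (h : P.NoPreconditions) : P.RestrictionS := fun a _ v ha _ _ _ => absurd (h a v) ha

end ParamPlanning

theorem mainTheorem2 :
    ParamPlanning.W2Hard
      (ParamPlanning.boundedPlanning fun x => x.sas.RestrictionB ∧ x.sas.RestrictionS) ∧
    ParamPlanning.W2Hard
      (ParamPlanning.boundedPlanning fun x =>
        x.sas.RestrictionB ∧ x.sas.RestrictionS ∧ x.sas.NoPreconditions) := by
  have hS := fun x => (ParamPlanning.gapInst_noPreconditions x).restrictionS
  exact ⟨ParamPlanning.w2Hard_of_fptReduces <| ParamPlanning.fptReduces_boundedPlanning fun x =>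
      ⟨ParamPlanning.gapInst_restrictionB x, hS x⟩,
    ParamPlanning.w2Hard_of_fptReduces <| ParamPlanning.fptReduces_boundedPlanning fun x =>
      ⟨ParamPlanning.gapInst_restrictionB x, hS x, ParamPlanning.gapInst_noPreconditions x⟩⟩
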